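/- Let $n\ge 1$ and let $X_1,\dots,X_n$ be independent real random variables with a common distribution function $F$ that is continuous, and let $\mathcal F_i=\sigma\{X_1,\dots,X_i\}$. A feasible policy $\pi$ selects, online, values $X_{\tau_1}\le X_{\tau_2}\le\cdots\le X_{\tau_j}$ (with $j$ random) at times $1\le\tau_1<\tau_2<\cdots<\tau_j\le n$ that are stopping times with respect to $(\mathcal F_i)$, where $\tau_k=\infty$ if fewer than $k$ selections are made. Let $L_n(\pi)$ be the number of selections that $\pi$ makes. A feasible policy $\pi^*_n$ is called optimal if $\mathbb E[L_n(\pi^*_n)]=\sup_{\pi}\mathbb E[L_n(\pi)]$, the supremum being taken over all feasible policies. There are a constant $C$ and an integer $N$, neither depending on $F$, such that for all $n\ge N$ and all such $X_1,\dots,X_n$ an optimal policy exists, and every optimal policy $\pi^*_n$ satisfies $$\mathbb E[L_n(\pi^*_n)]\ \ge\ (2n)^{1/2}-C\log n .$$ -/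

import Mathlib

open MeasureTheory ProbabilityTheory

/-- `τ` is a feasible policy for the online selection of a monotone increasing subsequence from the
observations `X i`, `i : Fin n` (where `X i` is the `(i + 1)`-st observation).
`τ j ω` is the time at which the `(j + 1)`-st selection is made, with `τ j ω = ⊤` if fewer than
`j + 1` selections are made on the outcome `ω`. Every `τ j` is a stopping time for the `σ`-fields
generated by the observations seen so far, selection times are strictly increasing, and the
selected values are nondecreasing. -/
structure IsFeasiblePolicy {Ω : Type*} [MeasurableSpace Ω] {n : ℕ} (X : Fin n → Ω → ℝ)
    (hX : ∀ i, StronglyMeasurable (X i)) (τ : Fin n → Ω → WithTop (Fin n)) : Prop where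
  isStoppingTime : ∀ j, IsStoppingTime (Filtration.natural X hX) (τ j)
  lt_of_lt : ∀ ω j k, j < k → τ k ω ≠ ⊤ → τ j ω < τ k ω
  monotone : ∀ ω j k, j < k → ∀ a b : Fin n, τ j ω = a → τ k ω = b → X a ω ≤ X b ω

open Classical in
/-- The number of selections made by the policy `τ` on the outcome `ω`. -/
noncomputable def numSelections {Ω : Type*} {n : ℕ} (τ : Fin n → Ω → WithTop (Fin n))
    (ω : Ω) : ℕ :=
  (Finset.univ.filter fun j => τ j ω ≠ ⊤).card

/-- The expected number of selections made by the policy `τ`. -/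
noncomputable def expectedSelections {Ω : Type*} [MeasurableSpace Ω] (P : Measure Ω) {n : ℕ}
    (τ : Fin n → Ω → WithTop (Fin n)) : ℝ :=
  ∫ ω, (numSelections τ ω : ℝ) ∂P

/-- The number of selections made by a feasible policy is a bounded random variable, so that its
expectation is a genuine one. -/
theorem IsFeasiblePolicy.integrable_numSelections {Ω : Type*} [MeasurableSpace Ω] (P : Measure Ω)
    [IsProbabilityMeasure P] {n : ℕ} {X : Fin n → Ω → ℝ} {hX : ∀ i, StronglyMeasurable (X i)}
    {τ : Fin n → Ω → WithTop (Fin n)} (hτ : IsFeasiblePolicy X hX τ) :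
    Integrable (fun ω => (numSelections τ ω : ℝ)) P := by
  classical
  have hm : ∀ j, MeasurableSet {ω | τ j ω ≠ ⊤} := by
    intro j
    have h : {ω | τ j ω ≠ ⊤} = ⋃ i : Fin n, {ω | τ j ω ≤ i} := by
      ext ω
      simp only [Set.mem_ofPred_eq, Set.mem_iUnion]
      constructor
      · intro h
        obtain ⟨i, hi⟩ := WithTop.ne_top_iff_exists.1 h
        exact ⟨i, hi.symm.le⟩
      · rintro ⟨i, hi⟩ h
        simp [h] at hi
    rw [h]
    exact MeasurableSet.iUnion fun i =>
      (Filtration.natural X hX).le i _ (hτ.isStoppingTime j i)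
  have he : (fun ω => (numSelections τ ω : ℝ)) =
      fun ω => ∑ j, Set.indicator {ω | τ j ω ≠ ⊤} (fun _ => (1 : ℝ)) ω := by
    funext ω
    simp [numSelections, Set.indicator_apply, Finset.sum_ite]
  rw [he]
  exact integrable_finsetSum _ fun j _ => (integrable_const 1).indicator (hm j)

/-- The policy `τ` is optimal: it is feasible and no feasible policy has a larger expected number
of selections. -/
def IsOptimalPolicy {Ω : Type*} [MeasurableSpace Ω] (P : Measure Ω) {n : ℕ} (X : Fin n → Ω → ℝ)
    (hX : ∀ i, StronglyMeasurable (X i)) (τ : Fin n → Ω → WithTop (Fin n)) : Prop :=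
  IsFeasiblePolicy X hX τ ∧
    ∀ σ, IsFeasiblePolicy X hX σ → expectedSelections P σ ≤ expectedSelections P τ

/-!
The problem is a finite-horizon dynamic program whose state is the last selected value. Let
`selectionValue F k s` be the value of the state `s` with `k` observations to come, defined by the
Bellman recursion. For an arbitrary adapted family of selection events, independence of the next
observation from the past gives the identity `sum_measureReal_eq`: the expected number of selections
equals `selectionValue F n ⊥` minus the expected sum of the losses incurred by the single decisions.
The losses of a feasible policy are nonnegative, and those of the policy that maximizes the value at
every decision vanish. Hence this greedy policy is optimal (`isOptimalPolicy_greedy`), and the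
optimal expected number of selections is `selectionValue F n ⊥`.

The lower bound is a subsolution argument (`lowerValue_le_selectionValue`). If `m` is the expected
number of admissible observations to come, `m = k (1 - F(s))`, then `selectionValue F k s` is at
least `φ(m) = √(2m) - 2 log (1 + m) - 3`. Since the distribution function is continuous, it maps the
observations to uniform ones (`map_cdf_eq_restrict_volume`). With `r = √(2m)`, select the next
observation `x` when `0 ≤ F(x) - F(s) ≤ r / k`. A selection with `v = k (F(x) - F(s))` gains `1` and
lowers `φ` by at most `v / r + 2 v² / r³`, so that the expected gain is at least
`(r / 2 - 2 / 3) / k`. The square root grows by at most `r / (2 k)` when `k` increases by one, and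
the logarithmic term pays for the remaining `2 / (3 k)`. When `m < 2` there is nothing to prove,
since `φ ≤ 0` on `[0, 3]`.
-/

/-! ### The dynamic programming recursion -/

/-- The best value obtainable when the observation `x` is offered, the last selected value is `s`,
and `v` is the value of the problem that remains after the decision: an observation `x ≥ s` may be
selected, which gains `1` and changes the state to `x`. -/
noncomputable def offerValue (v : EReal → ℝ) (s : EReal) (x : ℝ) : ℝ :=
  if s ≤ x then max (v s) (1 + v x) else v s

/-- `selectionValue F k s` is the optimal expected number of selections from `k` further independent
observations with law `F` when the last selected value is `s`. The state is an extended real, with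
`⊥` standing for "nothing has been selected yet". -/
noncomputable def selectionValue (F : Measure ℝ) : ℕ → EReal → ℝ
  | 0, _ => 0
  | k + 1, s => ∫ x, offerValue (selectionValue F k) s x ∂F

theorem le_offerValue (v : EReal → ℝ) (s : EReal) (x : ℝ) : v s ≤ offerValue v s x := by
  unfold offerValue
  split_ifs
  · exact le_max_left _ _
  · exact le_rfl

theorem offerValue_le {v : EReal → ℝ} {c : ℝ} (hv : ∀ s, v s ≤ c) (s : EReal) (x : ℝ) :
    offerValue v s x ≤ c + 1 := by
  unfold offerValue
  split_ifs
  · exact max_le (by linarith [hv s]) (by linarith [hv x])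
  · linarith [hv s]

theorem measurable_offerValue {v : EReal → ℝ} (hv : Measurable v) :
    Measurable (Function.uncurry (offerValue v)) := by
  have h : Measurable fun p : EReal × ℝ => (p.2 : EReal) :=
    measurable_coe_real_ereal.comp measurable_snd
  exact Measurable.ite (measurableSet_le measurable_fst h)
    ((hv.comp measurable_fst).max ((hv.comp h).const_add 1)) (hv.comp measurable_fst)

section Value

variable (F : Measure ℝ) [IsProbabilityMeasure F]

theorem measurable_selectionValue (k : ℕ) : Measurable (selectionValue F k) := by
  induction k with
  | zero => exact measurable_const
  | succ k ih =>
    exact (measurable_offerValue ih).stronglyMeasurable.integral_prod_right.measurable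

theorem selectionValue_mem_Icc (k : ℕ) (s : EReal) :
    selectionValue F k s ∈ Set.Icc (0 : ℝ) k := by
  induction k generalizing s with
  | zero => simp [selectionValue]
  | succ k ih =>
    have h0 : ∀ x, 0 ≤ offerValue (selectionValue F k) s x := fun x =>
      (ih s).1.trans (le_offerValue _ _ _)
    refine ⟨integral_nonneg h0, ?_⟩
    have h := integral_mono_of_nonneg (μ := F) (Filter.Eventually.of_forall h0)
      (integrable_const ((k : ℝ) + 1))
      (Filter.Eventually.of_forall fun x => offerValue_le (fun s => (ih s).2) s x)
    simpa [selectionValue] using h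

theorem offerValue_selectionValue_mem_Icc (k : ℕ) (s : EReal) (x : ℝ) :
    offerValue (selectionValue F k) s x ∈ Set.Icc (0 : ℝ) (k + 1) :=
  ⟨(selectionValue_mem_Icc F k s).1.trans (le_offerValue _ _ _),
    offerValue_le (fun s => (selectionValue_mem_Icc F k s).2) s x⟩

theorem integrable_offerValue (k : ℕ) (s : EReal) :
    Integrable (offerValue (selectionValue F k) s) F :=
  Integrable.of_mem_Icc 0 (k + 1)
    ((measurable_offerValue (measurable_selectionValue F k)).comp
      measurable_prodMk_left).aemeasurable
    (Filter.Eventually.of_forall fun x => offerValue_selectionValue_mem_Icc F k s x)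

variable {Ω : Type*} [MeasurableSpace Ω] {P : Measure Ω} [IsProbabilityMeasure P]

/-- A fresh observation that is independent of the state turns the value of the offer into the
value of the state with one more observation to come. -/
theorem integral_offerValue_of_indepFun (k : ℕ) {S : Ω → EReal} {Y : Ω → ℝ} (hS : Measurable S)
    (hY : Measurable Y) (hSY : IndepFun S Y P) (hF : P.map Y = F) :
    ∫ ω, offerValue (selectionValue F k) (S ω) (Y ω) ∂P =
      ∫ ω, selectionValue F (k + 1) (S ω) ∂P := by
  have hm := measurable_offerValue (measurable_selectionValue F k)
  have hmap := (indepFun_iff_map_prod_eq_prod_map_map hS.aemeasurable hY.aemeasurable).1 hSY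
  rw [hF] at hmap
  have : IsProbabilityMeasure (P.map S) := Measure.isProbabilityMeasure_map hS.aemeasurable
  have h1 : ∫ ω, offerValue (selectionValue F k) (S ω) (Y ω) ∂P =
      ∫ p, Function.uncurry (offerValue (selectionValue F k)) p
        ∂P.map (fun ω => (S ω, Y ω)) :=
    (integral_map (hS.prodMk hY).aemeasurable hm.aestronglyMeasurable).symm
  have hint : Integrable (Function.uncurry (offerValue (selectionValue F k)))
      ((P.map S).prod F) :=
    Integrable.of_mem_Icc 0 (k + 1) hm.aemeasurable
      (Filter.Eventually.of_forall fun p => offerValue_selectionValue_mem_Icc F k p.1 p.2)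
  rw [h1, hmap, integral_prod _ hint]
  exact integral_map hS.aemeasurable
    (measurable_selectionValue F (k + 1)).aestronglyMeasurable

end Value

/-! ### Families of selection events -/

section LastSelected

variable {Ω : Type*} {n : ℕ}

open Classical in
/-- The value selected last among the first `i` observations, when observation `l` is selected on
the event `A l`; it is `⊥` as long as nothing has been selected. -/
noncomputable def lastSelected (X : Fin n → Ω → ℝ) (A : Fin n → Set Ω) : ℕ → Ω → EReal
  | 0, _ => ⊥
  | i + 1, ω => if h : i < n then
      if ω ∈ A ⟨i, h⟩ then (X ⟨i, h⟩ ω : EReal) else lastSelected X A i ω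
    else lastSelected X A i ω

theorem lastSelected_succ_of_mem (X : Fin n → Ω → ℝ) {A : Fin n → Set Ω} {i : Fin n} {ω : Ω}
    (h : ω ∈ A i) : lastSelected X A (i + 1) ω = X i ω := by
  simp [lastSelected, h]

theorem lastSelected_succ_of_notMem (X : Fin n → Ω → ℝ) {A : Fin n → Set Ω} {i : Fin n} {ω : Ω}
    (h : ω ∉ A i) : lastSelected X A (i + 1) ω = lastSelected X A i ω := by
  simp [lastSelected, h]

theorem lastSelected_le_of_forall {X : Fin n → Ω → ℝ} {A : Fin n → Set Ω} {ω : Ω} {c : EReal}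
    (i : ℕ) (h : ∀ l : Fin n, l.1 < i → ω ∈ A l → (X l ω : EReal) ≤ c) :
    lastSelected X A i ω ≤ c := by
  induction i with
  | zero => exact bot_le
  | succ i ih =>
    have ih' := ih fun l hl => h l (hl.trans i.lt_succ_self)
    simp only [lastSelected]
    split_ifs with hi hA
    · exact h ⟨i, hi⟩ i.lt_succ_self hA
    · exact ih'
    · exact ih'

theorem le_lastSelected {X : Fin n → Ω → ℝ} {A : Fin n → Set Ω} {ω : Ω}
    (hA : ∀ i : Fin n, ω ∈ A i → lastSelected X A i ω ≤ X i ω) {l : Fin n} (hl : ω ∈ A l)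
    {i : ℕ} (hi : l.1 < i) : (X l ω : EReal) ≤ lastSelected X A i ω := by
  induction i, hi using Nat.le_induction with
  | base => rw [lastSelected_succ_of_mem X hl]
  | succ i _ ih =>
    simp only [lastSelected]
    split_ifs with hi hAi
    · exact ih.trans (hA ⟨i, hi⟩ hAi)
    · exact ih
    · exact ih

/-- The `σ`-field generated by the observations before time `i`. -/
abbrev pastSigma (X : Fin n → Ω → ℝ) (i : ℕ) : MeasurableSpace Ω :=
  ⨆ l : Fin n, ⨆ _ : l.1 < i, MeasurableSpace.comap (X l) inferInstance

theorem pastSigma_mono (X : Fin n → Ω → ℝ) {i j : ℕ} (h : i ≤ j) :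
    pastSigma X i ≤ pastSigma X j :=
  iSup_mono fun _ => iSup_mono' fun hl => ⟨hl.trans_le h, le_rfl⟩

theorem measurable_pastSigma (X : Fin n → Ω → ℝ) {l : Fin n} {i : ℕ} (h : l.1 < i) :
    Measurable[pastSigma X i] (X l) :=
  Measurable.of_comap_le (le_iSup₂_of_le l h le_rfl)

/-- If every decision depends on the observations seen so far only, so does the last selected
value. -/
theorem measurable_lastSelected {X : Fin n → Ω → ℝ} {A : Fin n → Set Ω} (i : ℕ)
    (hA : ∀ l : Fin n, l.1 < i → MeasurableSet[pastSigma X (l + 1)] (A l)) :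
    Measurable[pastSigma X i] (lastSelected X A i) := by
  classical
  induction i with
  | zero => exact measurable_const
  | succ i ih =>
    have ih' : Measurable[pastSigma X (i + 1)] (lastSelected X A i) :=
      (ih fun l hl => hA l (hl.trans i.lt_succ_self)).mono
        (pastSigma_mono X i.le_succ) le_rfl
    by_cases h : i < n
    · have he : lastSelected X A (i + 1) =
          fun ω => if ω ∈ A ⟨i, h⟩ then (X ⟨i, h⟩ ω : EReal) else lastSelected X A i ω := by
        funext ω
        simp [lastSelected, h]
      rw [he]
      exact Measurable.ite (hA ⟨i, h⟩ i.lt_succ_self)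
        (measurable_coe_real_ereal.comp (measurable_pastSigma X i.lt_succ_self)) ih'
    · have he : lastSelected X A (i + 1) = lastSelected X A i := by
        funext ω
        simp [lastSelected, h]
      rw [he]
      exact ih'

variable [MeasurableSpace Ω]

theorem pastSigma_le {X : Fin n → Ω → ℝ} (hX : ∀ i, StronglyMeasurable (X i)) (i : ℕ) :
    pastSigma X i ≤ ‹MeasurableSpace Ω› :=
  iSup₂_le fun l _ => (hX l).measurable.comap_le

theorem natural_eq_pastSigma {X : Fin n → Ω → ℝ} (hX : ∀ i, StronglyMeasurable (X i))
    (i : Fin n) : Filtration.natural X hX i = pastSigma X (i + 1) := by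
  have h : ∀ l : Fin n, l ≤ i ↔ l.1 < i.1 + 1 := fun l => Nat.lt_succ_iff.symm
  simp only [Filtration.natural, pastSigma, ← h]

theorem indepFun_of_measurable_pastSigma {X : Fin n → Ω → ℝ}
    (hX : ∀ i, StronglyMeasurable (X i)) {P : Measure Ω} (hind : iIndepFun X P) (i : Fin n)
    {S : Ω → EReal} (hS : Measurable[pastSigma X i] S) : IndepFun S (X i) P := by
  have h := indep_iSup_of_disjoint (fun l => (hX l).measurable.comap_le) hind.iIndep
    (S := {l : Fin n | l.1 < i.1}) (T := {i}) (by simp)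
  rw [IndepFun_iff_Indep]
  refine indep_of_indep_of_le_left (indep_of_indep_of_le_right h ?_) (hS.comap_le)
  simp

end LastSelected

/-! ### Verification -/

section Loss

variable {Ω : Type*} {F : Measure ℝ} {n : ℕ} {X : Fin n → Ω → ℝ}

/-- The value lost by the decision at time `i`, compared with the best decision available. -/
noncomputable def decisionLoss (F : Measure ℝ) (X : Fin n → Ω → ℝ) (A : Fin n → Set Ω)
    (i : Fin n) (ω : Ω) : ℝ :=
  offerValue (selectionValue F (n - (i + 1))) (lastSelected X A i ω) (X i ω) -
    ((A i).indicator (fun _ => 1) ω +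
      selectionValue F (n - (i + 1)) (lastSelected X A (i + 1) ω))

theorem decisionLoss_nonneg {A : Fin n → Set Ω} {i : Fin n} {ω : Ω}
    (h : ω ∈ A i → lastSelected X A i ω ≤ X i ω) : 0 ≤ decisionLoss F X A i ω := by
  unfold decisionLoss
  by_cases hA : ω ∈ A i
  · rw [lastSelected_succ_of_mem X hA, offerValue, if_pos (h hA), Set.indicator_of_mem hA]
    exact sub_nonneg.2 (le_max_right _ _)
  · rw [lastSelected_succ_of_notMem X hA, Set.indicator_of_notMem hA, zero_add]
    exact sub_nonneg.2 (le_offerValue _ _ _)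

theorem decisionLoss_eq_zero {A : Fin n → Set Ω} {i : Fin n} {ω : Ω}
    (h : ω ∈ A i ↔ lastSelected X A i ω ≤ X i ω ∧
      selectionValue F (n - (i + 1)) (lastSelected X A i ω) ≤
        1 + selectionValue F (n - (i + 1)) (X i ω)) :
    decisionLoss F X A i ω = 0 := by
  unfold decisionLoss
  by_cases hA : ω ∈ A i
  · obtain ⟨h1, h2⟩ := h.1 hA
    rw [lastSelected_succ_of_mem X hA, offerValue, if_pos h1, Set.indicator_of_mem hA,
      max_eq_right h2, sub_self]
  · rw [lastSelected_succ_of_notMem X hA, Set.indicator_of_notMem hA, zero_add, sub_eq_zero]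
    unfold offerValue
    split_ifs with h1
    · exact max_eq_left (not_le.1 fun h2 => hA (h.2 ⟨h1, h2⟩)).le
    · rfl

end Loss

section Verification

variable {Ω : Type*} [MeasurableSpace Ω] {P : Measure Ω} [IsProbabilityMeasure P]
  {F : Measure ℝ} [IsProbabilityMeasure F] {n : ℕ} {X : Fin n → Ω → ℝ}

/-- The expected number of selections is the optimal value minus the expected total loss. -/
theorem sum_measureReal_eq (hX : ∀ i, StronglyMeasurable (X i)) (hF : ∀ i, P.map (X i) = F)
    (hind : iIndepFun X P) {A : Fin n → Set Ω}
    (hA : ∀ i : Fin n, MeasurableSet[pastSigma X (i + 1)] (A i)) :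
    ∑ i, P.real (A i) = selectionValue F n ⊥ - ∑ i, ∫ ω, decisionLoss F X A i ω ∂P := by
  have hS : ∀ i, Measurable (lastSelected X A i) := fun i =>
    (measurable_lastSelected i fun l _ => hA l).mono (pastSigma_le hX i) le_rfl
  have hV : ∀ k i, Integrable (fun ω => selectionValue F k (lastSelected X A i ω)) P :=
    fun k i => Integrable.of_mem_Icc 0 k
      ((measurable_selectionValue F k).comp (hS i)).aemeasurable
      (Filter.Eventually.of_forall fun ω => selectionValue_mem_Icc F k _)
  have hAm : ∀ i, MeasurableSet (A i) := fun i => pastSigma_le hX _ _ (hA i)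
  let E : ℕ → ℝ := fun i => ∫ ω, selectionValue F (n - i) (lastSelected X A i ω) ∂P
  have key : ∀ i : Fin n, ∫ ω, decisionLoss F X A i ω ∂P =
      E i - P.real (A i) - E (i + 1) := by
    intro i
    have hG : Integrable (fun ω => offerValue (selectionValue F (n - (i + 1)))
        (lastSelected X A i ω) (X i ω)) P :=
      Integrable.of_mem_Icc 0 (((n - (i + 1) : ℕ) : ℝ) + 1)
        ((measurable_offerValue (measurable_selectionValue F _)).comp
          ((hS i).prodMk (hX i).measurable)).aemeasurable
        (Filter.Eventually.of_forall fun ω => offerValue_selectionValue_mem_Icc F _ _ _)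
    have hI : Integrable ((A i).indicator fun _ => (1 : ℝ)) P :=
      (integrable_const 1).indicator (hAm i)
    have hi : n - i = n - (i + 1) + 1 := by have := i.2; omega
    have h1 := integral_offerValue_of_indepFun F (n - (i + 1)) (hS i) (hX i).measurable
      (indepFun_of_measurable_pastSigma hX hind i (measurable_lastSelected i fun l _ => hA l))
      (hF i)
    have hIV : Integrable (fun ω => (A i).indicator (fun _ => (1 : ℝ)) ω +
        selectionValue F (n - (i + 1)) (lastSelected X A (i + 1) ω)) P := hI.add (hV _ _)
    simp only [decisionLoss, E]
    rw [integral_sub hG hIV, integral_add hI (hV _ _), h1, ← hi,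
      integral_indicator_const _ (hAm i)]
    simp only [smul_eq_mul, mul_one]
    ring
  have h0 : E 0 = selectionValue F n ⊥ := by simp [E, lastSelected]
  have hn : E n = 0 := by simp [E, selectionValue]
  have htel : ∑ i : Fin n, (E i - E (i + 1)) = E 0 - E n := by
    rw [Fin.sum_univ_eq_sum_range fun i => E i - E (i + 1), Finset.sum_range_sub']
  have hsum : ∑ i, ∫ ω, decisionLoss F X A i ω ∂P =
      ∑ i : Fin n, (E i - E (i + 1)) - ∑ i, P.real (A i) := by
    rw [← Finset.sum_sub_distrib]
    exact Finset.sum_congr rfl fun i _ => by rw [key i]; ring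
  rw [hsum, htel, h0, hn]
  ring

end Verification

/-! ### Policies and selection events -/

section Policy

variable {Ω : Type*} {n : ℕ}

/-- The event that the policy `τ` selects the observation `i`. -/
def selectionEvent (τ : Fin n → Ω → WithTop (Fin n)) (i : Fin n) : Set Ω :=
  {ω | ∃ j, τ j ω = i}

open Classical in
theorem numSelections_eq_card (τ : Fin n → Ω → WithTop (Fin n)) (ω : Ω)
    (hτ : ∀ j k, j < k → τ k ω ≠ ⊤ → τ j ω < τ k ω) :
    numSelections τ ω = (Finset.univ.filter fun i => ω ∈ selectionEvent τ i).card := by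
  unfold numSelections
  refine Finset.card_bij (fun j hj => (τ j ω).untop (Finset.mem_filter.1 hj).2) ?_ ?_ ?_
  · intro j hj
    simp only [Finset.mem_filter, Finset.mem_univ, true_and]
    exact ⟨j, (WithTop.coe_untop _ _).symm⟩
  · intro j hj k hk h
    have hj' := (Finset.mem_filter.1 hj).2
    have hk' := (Finset.mem_filter.1 hk).2
    have he : τ j ω = τ k ω := by
      rw [← WithTop.coe_untop _ hj', ← WithTop.coe_untop _ hk', h]
    rcases lt_trichotomy j k with hjk | hjk | hjk
    · exact absurd he (hτ j k hjk hk').ne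
    · exact hjk
    · exact absurd he (hτ k j hjk hj').ne'
  · intro i hi
    obtain ⟨j, hj⟩ := (Finset.mem_filter.1 hi).2
    exact ⟨j, by simp [hj], by simp [hj]⟩

open Classical in
theorem integral_card_filter_mem [MeasurableSpace Ω] (P : Measure Ω) [IsProbabilityMeasure P]
    {A : Fin n → Set Ω} (hA : ∀ i, MeasurableSet (A i)) :
    ∫ ω, ((Finset.univ.filter fun i => ω ∈ A i).card : ℝ) ∂P = ∑ i, P.real (A i) := by
  have he : ∀ ω, ((Finset.univ.filter fun i => ω ∈ A i).card : ℝ) =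
      ∑ i, (A i).indicator (fun _ => (1 : ℝ)) ω := by
    intro ω
    simp [Set.indicator_apply]
  simp_rw [he]
  rw [integral_finsetSum _ fun i _ => (integrable_const 1).indicator (hA i)]
  exact Finset.sum_congr rfl fun i _ => by
    rw [integral_indicator_const _ (hA i), smul_eq_mul, mul_one]

open Classical in
/-- The number of selections before time `i`. -/
noncomputable def selectionsBefore (A : Fin n → Set Ω) (i : ℕ) (ω : Ω) : ℕ :=
  (Finset.univ.filter fun l : Fin n => l.1 < i ∧ ω ∈ A l).card

theorem selectionsBefore_lt {A : Fin n → Set Ω} {ω : Ω} {l : Fin n} (hl : ω ∈ A l) {i : ℕ}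
    (hi : l.1 < i) : selectionsBefore A l ω < selectionsBefore A i ω := by
  classical
  refine Finset.card_lt_card (Finset.ssubset_iff_of_subset ?_ |>.2 ⟨l, ?_, ?_⟩)
  · exact Finset.monotone_filter_right _ fun m _ hm => ⟨hm.1.trans hi, hm.2⟩
  · simp [hi, hl]
  · simp

theorem selectionsBefore_lt_card (A : Fin n → Set Ω) (i : Fin n) (ω : Ω) :
    selectionsBefore A i ω < n := by
  classical
  calc selectionsBefore A i ω < (Finset.univ : Finset (Fin n)).card := by
        refine Finset.card_lt_card (Finset.ssubset_iff_of_subset (Finset.filter_subset _ _)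
          |>.2 ⟨i, Finset.mem_univ i, ?_⟩)
        simp
    _ = n := by simp

open Classical in
/-- The policy that selects the observation `i` on the event `A i`. Its selection number `j + 1`
(with `j` counted from `0`) takes place at the unique such `i` with exactly `j` selections before
it. -/
noncomputable def policyOfEvents (A : Fin n → Set Ω) (j : Fin n) (ω : Ω) : WithTop (Fin n) :=
  if h : ∃ i : Fin n, ω ∈ A i ∧ selectionsBefore A i ω = j then (h.choose : WithTop (Fin n))
  else ⊤

theorem policyOfEvents_eq_iff {A : Fin n → Set Ω} {j i : Fin n} {ω : Ω} :
    policyOfEvents A j ω = i ↔ ω ∈ A i ∧ selectionsBefore A i ω = j := by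
  have huniq : ∀ l m : Fin n, ω ∈ A l → ω ∈ A m →
      selectionsBefore A l ω = selectionsBefore A m ω → l = m := by
    intro l m hl hm h
    rcases lt_trichotomy l m with hlm | hlm | hlm
    · exact absurd h (selectionsBefore_lt hl hlm).ne
    · exact hlm
    · exact absurd h (selectionsBefore_lt hm hlm).ne'
  unfold policyOfEvents
  split_ifs with h
  · have hc := h.choose_spec
    rw [WithTop.coe_inj]
    constructor
    · rintro rfl
      exact hc
    · intro hi
      exact huniq _ _ hc.1 hi.1 (hc.2.trans hi.2.symm)
  · simp only [WithTop.top_ne_coe, false_iff]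
    exact fun hi => h ⟨i, hi⟩

theorem selectionEvent_policyOfEvents (A : Fin n → Set Ω) :
    selectionEvent (policyOfEvents A) = A := by
  funext i
  ext ω
  constructor
  · rintro ⟨j, hj⟩
    exact (policyOfEvents_eq_iff.1 hj).1
  · intro h
    exact ⟨⟨_, selectionsBefore_lt_card A i ω⟩, policyOfEvents_eq_iff.2 ⟨h, rfl⟩⟩

/-- The counting process moves in unit steps, so every number of selections below the current one
was the count just before some selection. -/
theorem selectionsBefore_exists {A : Fin n → Set Ω} {ω : Ω} (i c : ℕ)
    (h : c < selectionsBefore A i ω) :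
    ∃ l : Fin n, l.1 < i ∧ ω ∈ A l ∧ selectionsBefore A l ω = c := by
  classical
  induction i with
  | zero => simp [selectionsBefore] at h
  | succ i ih =>
    by_cases hc : c < selectionsBefore A i ω
    · obtain ⟨l, hl, h'⟩ := ih hc
      exact ⟨l, hl.trans i.lt_succ_self, h'⟩
    · by_cases hi : ∃ hi : i < n, ω ∈ A ⟨i, hi⟩
      · obtain ⟨hi, hA⟩ := hi
        refine ⟨⟨i, hi⟩, i.lt_succ_self, hA, ?_⟩
        have hle : selectionsBefore A (i + 1) ω ≤ selectionsBefore A i ω + 1 := by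
          unfold selectionsBefore
          refine (Finset.card_le_card ?_).trans (Finset.card_insert_le (⟨i, hi⟩ : Fin n) _)
          intro l hl
          simp only [Finset.mem_filter, Finset.mem_univ, true_and, Finset.mem_insert] at hl ⊢
          rcases Nat.lt_succ_iff_lt_or_eq.1 hl.1 with h1 | h1
          · exact Or.inr ⟨h1, hl.2⟩
          · exact Or.inl (Fin.ext h1)
        simp only
        omega
      · exfalso
        have hle : selectionsBefore A (i + 1) ω ≤ selectionsBefore A i ω := by
          refine Finset.card_le_card fun l hl => ?_
          simp only [Finset.mem_filter, Finset.mem_univ, true_and] at hl ⊢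
          refine ⟨lt_of_le_of_ne (Nat.lt_succ_iff.1 hl.1) fun h1 => hi ?_, hl.2⟩
          subst h1
          exact ⟨l.2, hl.2⟩
        omega

theorem measurableSet_selectionsBefore_eq {X : Fin n → Ω → ℝ} {A : Fin n → Set Ω} (i : ℕ)
    (hA : ∀ l : Fin n, l.1 < i → MeasurableSet[pastSigma X i] (A l)) (c : ℕ) :
    MeasurableSet[pastSigma X i] {ω | selectionsBefore A i ω = c} := by
  classical
  have he : selectionsBefore A i =
      fun ω => ∑ l : Fin n, if l.1 < i then (A l).indicator (fun _ => (1 : ℕ)) ω else 0 := by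
    funext ω
    simp only [selectionsBefore, Finset.card_filter, Set.indicator_apply, ite_and]
  have hm : Measurable[pastSigma X i] (selectionsBefore A i) := by
    rw [he]
    refine Finset.measurable_sum _ fun l _ => ?_
    split_ifs with h
    · exact (@measurable_const _ _ _ (pastSigma X i) 1).indicator (hA l h)
    · exact measurable_const
  exact hm (measurableSet_singleton c)

variable [MeasurableSpace Ω] {X : Fin n → Ω → ℝ} {hX : ∀ i, StronglyMeasurable (X i)}

/-- A family of adapted events defines a feasible policy if an observation is selected only when it
is at least the last selected value. -/
theorem isFeasiblePolicy_policyOfEvents {A : Fin n → Set Ω}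
    (hA : ∀ i : Fin n, MeasurableSet[pastSigma X (i + 1)] (A i))
    (hle : ∀ i : Fin n, ∀ ω ∈ A i, lastSelected X A i ω ≤ X i ω) :
    IsFeasiblePolicy X hX (policyOfEvents A) where
  isStoppingTime j := by
    refine isStoppingTime_of_measurableSet_eq fun i => ?_
    have he : {ω | policyOfEvents A j ω = i} = A i ∩ {ω | selectionsBefore A i ω = j} := by
      ext ω
      exact policyOfEvents_eq_iff
    rw [he, natural_eq_pastSigma]
    refine MeasurableSet.inter (hA i) ?_
    exact pastSigma_mono X i.1.le_succ _ (measurableSet_selectionsBefore_eq i.1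
      (fun l hl => pastSigma_mono X hl _ (hA l)) j)
  lt_of_lt ω j k hjk hk := by
    obtain ⟨b, hb⟩ := WithTop.ne_top_iff_exists.1 hk
    have hb' := policyOfEvents_eq_iff.1 hb.symm
    obtain ⟨a, hab, ha⟩ := selectionsBefore_exists (A := A) (ω := ω) b.1 j.1
      (by rw [hb'.2]; exact hjk)
    rw [policyOfEvents_eq_iff.2 ha, ← hb]
    exact WithTop.coe_lt_coe.2 hab
  monotone ω j k hjk a b ha hb := by
    have ha' := policyOfEvents_eq_iff.1 ha
    have hb' := policyOfEvents_eq_iff.1 hb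
    have hab : a < b := by
      by_contra h
      rcases (not_lt.1 h).eq_or_lt with h | h
      · subst h
        exact hjk.ne (Fin.ext (ha'.2.symm.trans hb'.2))
      · have := selectionsBefore_lt hb'.1 h
        rw [ha'.2, hb'.2] at this
        exact absurd hjk (not_lt.2 (Fin.le_def.2 this.le))
    exact EReal.coe_le_coe_iff.1
      ((le_lastSelected (fun i => hle i ω) ha'.1 hab).trans (hle b ω hb'.1))

theorem IsFeasiblePolicy.measurableSet_selectionEvent {τ : Fin n → Ω → WithTop (Fin n)}
    (hτ : IsFeasiblePolicy X hX τ) (i : Fin n) :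
    MeasurableSet[pastSigma X (i + 1)] (selectionEvent τ i) := by
  have h : selectionEvent τ i = ⋃ j, {ω | τ j ω = i} := by
    ext ω
    simp [selectionEvent]
  rw [h, ← natural_eq_pastSigma hX]
  exact MeasurableSet.iUnion fun j => (hτ.isStoppingTime j).measurableSet_eq i

theorem IsFeasiblePolicy.lastSelected_le {τ : Fin n → Ω → WithTop (Fin n)}
    (hτ : IsFeasiblePolicy X hX τ) {i : Fin n} {ω : Ω} (hi : ω ∈ selectionEvent τ i) :
    lastSelected X (selectionEvent τ) i ω ≤ X i ω := by
  obtain ⟨k, hk⟩ := hi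
  refine lastSelected_le_of_forall i.1 ?_
  rintro l hl ⟨j, hj⟩
  rw [EReal.coe_le_coe_iff]
  refine hτ.monotone ω j k ?_ l i hj hk
  by_contra h
  rcases (not_lt.1 h).eq_or_lt with h | h
  · subst h
    rw [hj, WithTop.coe_inj] at hk
    exact hl.ne (congrArg Fin.val hk)
  · have := hτ.lt_of_lt ω k j h (by simp [hj])
    rw [hj, hk, WithTop.coe_lt_coe] at this
    exact absurd hl (not_lt.2 (Fin.le_def.1 this.le))

theorem IsFeasiblePolicy.expectedSelections_eq (P : Measure Ω) [IsProbabilityMeasure P]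
    {τ : Fin n → Ω → WithTop (Fin n)} (hτ : IsFeasiblePolicy X hX τ) :
    expectedSelections P τ = ∑ i, P.real (selectionEvent τ i) := by
  classical
  rw [← integral_card_filter_mem P
    fun i => pastSigma_le hX _ _ (hτ.measurableSet_selectionEvent i)]
  unfold expectedSelections
  congr 1
  funext ω
  rw [numSelections_eq_card τ ω (hτ.lt_of_lt ω)]

end Policy

/-! ### The optimal policy -/

section Optimal

variable {Ω : Type*} {n : ℕ}

open Classical in
/-- The last selected value when an observation is selected as soon as this is admissible and
selecting it is at least as good as skipping it. -/
noncomputable def greedyState (F : Measure ℝ) (X : Fin n → Ω → ℝ) : ℕ → Ω → EReal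
  | 0, _ => ⊥
  | i + 1, ω => if h : i < n then
      if greedyState F X i ω ≤ X ⟨i, h⟩ ω ∧
          selectionValue F (n - (i + 1)) (greedyState F X i ω) ≤
            1 + selectionValue F (n - (i + 1)) (X ⟨i, h⟩ ω)
        then (X ⟨i, h⟩ ω : EReal) else greedyState F X i ω
    else greedyState F X i ω

/-- The event that the observation `i` is selected when every decision maximizes the value. -/
def greedyEvent (F : Measure ℝ) (X : Fin n → Ω → ℝ) (i : Fin n) : Set Ω :=
  {ω | greedyState F X i ω ≤ X i ω ∧ selectionValue F (n - (i + 1)) (greedyState F X i ω) ≤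
    1 + selectionValue F (n - (i + 1)) (X i ω)}

theorem lastSelected_greedyEvent (F : Measure ℝ) (X : Fin n → Ω → ℝ) (i : ℕ) (ω : Ω) :
    lastSelected X (greedyEvent F X) i ω = greedyState F X i ω := by
  induction i with
  | zero => rfl
  | succ i ih => simp only [lastSelected, greedyState, ih, greedyEvent, Set.mem_ofPred_eq]

theorem mem_greedyEvent_iff (F : Measure ℝ) (X : Fin n → Ω → ℝ) (i : Fin n) (ω : Ω) :
    ω ∈ greedyEvent F X i ↔ lastSelected X (greedyEvent F X) i ω ≤ X i ω ∧
      selectionValue F (n - (i + 1)) (lastSelected X (greedyEvent F X) i ω) ≤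
        1 + selectionValue F (n - (i + 1)) (X i ω) := by
  simp only [lastSelected_greedyEvent, greedyEvent, Set.mem_ofPred_eq]

theorem measurableSet_greedyEvent (F : Measure ℝ) [IsProbabilityMeasure F] (X : Fin n → Ω → ℝ)
    (i : Fin n) : MeasurableSet[pastSigma X (i + 1)] (greedyEvent F X i) := by
  induction i using WellFoundedLT.induction with
  | ind i ih =>
    have hS : Measurable[pastSigma X (i + 1)] (lastSelected X (greedyEvent F X) i) :=
      (measurable_lastSelected i.1 fun l hl => ih l hl).mono
        (pastSigma_mono X i.1.le_succ) le_rfl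
    have hXi : Measurable[pastSigma X (i + 1)] fun ω => (X i ω : EReal) :=
      measurable_coe_real_ereal.comp (measurable_pastSigma X i.1.lt_succ_self)
    have hv := measurable_selectionValue F (n - (i + 1))
    have he : greedyEvent F X i = {ω | lastSelected X (greedyEvent F X) i ω ≤ X i ω} ∩
        {ω | selectionValue F (n - (i + 1)) (lastSelected X (greedyEvent F X) i ω) ≤
          1 + selectionValue F (n - (i + 1)) (X i ω)} := by
      ext ω
      exact mem_greedyEvent_iff F X i ω
    rw [he]
    exact (measurableSet_le hS hXi).inter
      (measurableSet_le (hv.comp hS) ((hv.comp hXi).const_add 1))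

variable [MeasurableSpace Ω] {P : Measure Ω} [IsProbabilityMeasure P]
  {F : Measure ℝ} [IsProbabilityMeasure F] {X : Fin n → Ω → ℝ}
  {hX : ∀ i, StronglyMeasurable (X i)}

theorem IsFeasiblePolicy.expectedSelections_le {τ : Fin n → Ω → WithTop (Fin n)}
    (hτ : IsFeasiblePolicy X hX τ) (hF : ∀ i, P.map (X i) = F) (hind : iIndepFun X P) :
    expectedSelections P τ ≤ selectionValue F n ⊥ := by
  rw [hτ.expectedSelections_eq P,
    sum_measureReal_eq hX hF hind hτ.measurableSet_selectionEvent, sub_le_self_iff]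
  exact Finset.sum_nonneg fun i _ =>
    integral_nonneg fun ω => decisionLoss_nonneg hτ.lastSelected_le

theorem isFeasiblePolicy_greedy : IsFeasiblePolicy X hX (policyOfEvents (greedyEvent F X)) :=
  isFeasiblePolicy_policyOfEvents (measurableSet_greedyEvent F X)
    fun i ω h => ((mem_greedyEvent_iff F X i ω).1 h).1

theorem expectedSelections_greedy (hX : ∀ i, StronglyMeasurable (X i))
    (hF : ∀ i, P.map (X i) = F) (hind : iIndepFun X P) :
    expectedSelections P (policyOfEvents (greedyEvent F X)) = selectionValue F n ⊥ := by
  rw [(isFeasiblePolicy_greedy (hX := hX)).expectedSelections_eq P,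
    selectionEvent_policyOfEvents,
    sum_measureReal_eq hX hF hind (measurableSet_greedyEvent F X)]
  simp [decisionLoss_eq_zero (mem_greedyEvent_iff F X _ _)]

theorem isOptimalPolicy_greedy (hX : ∀ i, StronglyMeasurable (X i))
    (hF : ∀ i, P.map (X i) = F) (hind : iIndepFun X P) :
    IsOptimalPolicy P X hX (policyOfEvents (greedyEvent F X)) :=
  ⟨isFeasiblePolicy_greedy, fun _ hσ => (hσ.expectedSelections_le hF hind).trans_eq
    (expectedSelections_greedy hX hF hind).symm⟩

end Optimal

/-! ### The comparison function -/

/-- The function of `m` that bounds the optimal value from below, where `m` is the expected number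
of remaining observations that are still admissible. -/
noncomputable def lowerValue (m : ℝ) : ℝ :=
  √(2 * m) - 2 * Real.log (1 + m) - 3

theorem lowerValue_nonpos {m : ℝ} (h0 : 0 ≤ m) (h : m ≤ 3) : lowerValue m ≤ 0 := by
  have h1 : √(2 * m) ≤ 3 := Real.sqrt_le_iff.2 ⟨by norm_num, by linarith⟩
  have h2 : 0 ≤ Real.log (1 + m) := Real.log_nonneg (by linarith)
  unfold lowerValue
  linarith

/-- Selecting an observation costs at most `v / r + 2 v² / r³` when it reduces `m = r² / 2` to
`m - v`. -/
theorem lowerValue_sub_ge {r v : ℝ} (hr : 2 ≤ r) (hv : 0 ≤ v) (hvr : v ≤ r) :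
    lowerValue (r ^ 2 / 2) - v / r - 2 * v ^ 2 / r ^ 3 ≤ lowerValue (r ^ 2 / 2 - v) := by
  have hr0 : 0 < r := by linarith
  have h1 : √(2 * (r ^ 2 / 2)) = r := by
    rw [mul_div_cancel₀ _ two_ne_zero, Real.sqrt_sq hr0.le]
  have hmv : 0 ≤ r ^ 2 / 2 - v := by nlinarith
  have h2 : r - v / r - 2 * v ^ 2 / r ^ 3 ≤ √(2 * (r ^ 2 / 2 - v)) := by
    obtain ⟨t, rfl⟩ : ∃ t, v = t * r ^ 2 / 2 := ⟨2 * v / r ^ 2, by field_simp⟩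
    have ht0 : 0 ≤ t := by
      by_contra h
      nlinarith [mul_pos hr0 hr0]
    refine Real.le_sqrt_of_sq_le ?_
    have he : r - t * r ^ 2 / 2 / r - 2 * (t * r ^ 2 / 2) ^ 2 / r ^ 3 =
        r * (1 - t / 2 - t ^ 2 / 2) := by
      field_simp
    have ht1 : t ≤ 1 := by
      by_contra h
      nlinarith [mul_pos hr0 hr0]
    rw [he]
    -- `(1 - t) - (1 - t / 2 - t² / 2)² = (1 - t) t² (3 + t) / 4`
    have hp : 0 ≤ r ^ 2 * ((1 - t) * (t ^ 2 * (3 + t))) :=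
      mul_nonneg (sq_nonneg r) (mul_nonneg (by linarith) (mul_nonneg (sq_nonneg t) (by linarith)))
    nlinarith
  have h3 : Real.log (1 + (r ^ 2 / 2 - v)) ≤ Real.log (1 + r ^ 2 / 2) :=
    Real.log_le_log (by linarith) (by linarith)
  unfold lowerValue
  rw [h1]
  linarith

/-- The expected gain of one step with threshold `r / k` pays for the growth of the comparison
function. The logarithm absorbs the second order term `2 / 3`. -/
theorem lowerValue_add_le {r k y : ℝ} (hr : 2 ≤ r) (hk : 0 < k) (hy : y ≤ 1)
    (hm : k * y = r ^ 2 / 2) :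
    lowerValue (r ^ 2 / 2 + y) ≤ lowerValue (r ^ 2 / 2) + (r / 2 - 2 / 3) / k := by
  have hr0 : 0 < r := by linarith
  have hm2 : 2 ≤ r ^ 2 / 2 := by nlinarith
  have hy0 : 0 < y := by
    by_contra h
    nlinarith
  have h1 : √(2 * (r ^ 2 / 2)) = r := by
    rw [mul_div_cancel₀ _ two_ne_zero, Real.sqrt_sq hr0.le]
  have h2 : √(2 * (r ^ 2 / 2 + y)) ≤ r + y / r := by
    refine Real.sqrt_le_iff.2 ⟨by positivity, ?_⟩
    have he : (r + y / r) ^ 2 = r ^ 2 + 2 * y + (y / r) ^ 2 := by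
      field_simp
      ring
    rw [he]
    nlinarith [sq_nonneg (y / r)]
  have h3 : y / r = r / 2 / k := by
    field_simp
    linarith
  set m := r ^ 2 / 2 with hmdef
  have h4 : 1 / 3 / k ≤ Real.log (1 + (m + y)) - Real.log (1 + m) := by
    rw [← Real.log_div (by linarith) (by linarith)]
    refine le_trans ?_ (Real.one_sub_inv_le_log_of_pos (by apply div_pos <;> linarith))
    have he : 1 - ((1 + (m + y)) / (1 + m))⁻¹ = y / (1 + (m + y)) := by
      have : 1 + (m + y) ≠ 0 := by linarith
      have : 1 + m ≠ 0 := by linarith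
      field_simp
      ring
    rw [he, div_div, div_le_div_iff₀ (by positivity) (by linarith)]
    nlinarith
  have h5 : (r / 2 - 2 / 3) / k = r / 2 / k - 2 * (1 / 3 / k) := by ring
  unfold lowerValue
  rw [h1, h5]
  linarith

theorem le_lowerValue_of_three_le {n : ℝ} (hn : 3 ≤ n) :
    √(2 * n) - 7 * Real.log n ≤ lowerValue n := by
  have h1 : 1 ≤ Real.log n := by
    rw [Real.le_log_iff_exp_le (by linarith)]
    linarith [Real.exp_one_lt_d9]
  have h2 : Real.log (1 + n) ≤ 2 * Real.log n := by
    rw [← Real.log_rpow (by linarith)]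
    refine Real.log_le_log (by linarith) ?_
    norm_num
    nlinarith
  unfold lowerValue
  linarith

/-! ### The probability integral transform -/

/-- The distribution function of `F`, extended to the extended reals. -/
noncomputable def extendedCdf (F : Measure ℝ) (s : EReal) : ℝ := F.real {x : ℝ | (x : EReal) ≤ s}

theorem extendedCdf_bot (F : Measure ℝ) : extendedCdf F ⊥ = 0 := by simp [extendedCdf]

section Transform

variable (F : Measure ℝ) [IsProbabilityMeasure F]

theorem map_cdf_eq_restrict_volume (hF : Continuous (cdf F)) :
    F.map (cdf F) = volume.restrict (Set.Icc (0 : ℝ) 1) := by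
  have hm : Measurable (cdf F) := hF.measurable
  have : IsProbabilityMeasure (F.map (cdf F)) := Measure.isProbabilityMeasure_map hm.aemeasurable
  -- `cdf F` attains every value strictly between `0` and `1`.
  have hsurj : ∀ b : ℝ, 0 < b → b < 1 → ∃ x, cdf F x = b := by
    intro b h0 h1
    exact mem_range_of_exists_le_of_exists_ge hF
      (((tendsto_cdf_atBot F).eventually_lt_const h0).exists.imp fun _ h => h.le)
      (((tendsto_cdf_atTop F).eventually_const_lt h1).exists.imp fun _ h => h.le)
  refine Measure.ext_of_Iic _ _ fun a => ?_
  rw [Measure.map_apply hm measurableSet_Iic, Measure.restrict_apply measurableSet_Iic]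
  rcases lt_or_ge a 0 with ha | ha
  · have h1 : cdf F ⁻¹' Set.Iic a = ∅ :=
      Set.eq_empty_of_forall_notMem fun x hx => absurd (cdf_nonneg F x) (not_le.2 (hx.trans_lt ha))
    have h2 : Set.Iic a ∩ Set.Icc (0 : ℝ) 1 = ∅ :=
      Set.eq_empty_of_forall_notMem fun x hx => absurd hx.2.1 (not_le.2 (hx.1.trans_lt ha))
    rw [h1, h2, measure_empty, measure_empty]
  rcases le_or_gt 1 a with ha1 | ha1
  · have h1 : cdf F ⁻¹' Set.Iic a = Set.univ :=
      Set.eq_univ_of_forall fun x => (cdf_le_one F x).trans ha1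
    have h2 : Set.Iic a ∩ Set.Icc (0 : ℝ) 1 = Set.Icc 0 1 :=
      Set.inter_eq_right.2 fun x hx => hx.2.trans ha1
    rw [h1, h2, measure_univ, Real.volume_Icc]
    simp
  · have h2 : Set.Iic a ∩ Set.Icc (0 : ℝ) 1 = Set.Icc 0 a := by
      ext x
      simp only [Set.mem_inter_iff, Set.mem_Iic, Set.mem_Icc]
      constructor
      · exact fun h => ⟨h.2.1, h.1⟩
      · exact fun h => ⟨h.2, h.1, h.2.trans ha1.le⟩
    rw [h2, Real.volume_Icc, sub_zero]
    refine le_antisymm ?_ ?_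
    · refine le_of_forall_gt_imp_ge_of_dense fun c hc => ?_
      obtain ⟨b, hab, hb1, hbc⟩ : ∃ b, a < b ∧ b < 1 ∧ ENNReal.ofReal b ≤ c := by
        rcases eq_or_ne c ⊤ with rfl | hct
        · exact ⟨(a + 1) / 2, by linarith, by linarith, le_top⟩
        · have hc' : a < c.toReal := (ENNReal.ofReal_lt_iff_lt_toReal ha hct).1 hc
          obtain ⟨b, hb, hb'⟩ := exists_between (lt_min hc' ha1)
          exact ⟨b, hb, hb'.trans_le (min_le_right _ _),
            ENNReal.ofReal_le_of_le_toReal (hb'.le.trans (min_le_left _ _))⟩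
      obtain ⟨x, hx⟩ := hsurj b (ha.trans_lt hab) hb1
      refine le_trans (measure_mono (t := Set.Iic x) fun z hz => ?_) ?_
      · by_contra h
        have := monotone_cdf F (not_le.1 h).le
        rw [hx] at this
        exact absurd (this.trans hz) (not_le.2 hab)
      · rw [← ofReal_cdf, hx]
        exact hbc
    · rcases ha.eq_or_lt with rfl | ha0
      · simp
      obtain ⟨x, hx⟩ := hsurj a ha0 ha1
      rw [← hx, ofReal_cdf]
      exact measure_mono fun z hz => monotone_cdf F hz

theorem extendedCdf_coe (x : ℝ) : extendedCdf F x = cdf F x := by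
  have h : {z : ℝ | (z : EReal) ≤ x} = Set.Iic x := by
    ext z
    simp
  rw [cdf_eq_real, extendedCdf, h]

theorem extendedCdf_mem_Icc (s : EReal) : extendedCdf F s ∈ Set.Icc (0 : ℝ) 1 :=
  ⟨measureReal_nonneg, measureReal_le_one⟩

/-- Almost surely, an observation on the right side of the state on the scale of the distribution
function is admissible. -/
theorem ae_le_of_extendedCdf_le (hF : Continuous (cdf F)) (s : EReal) :
    ∀ᵐ x ∂F, extendedCdf F s ≤ cdf F x → s ≤ x := by
  have h : ∀ᵐ x ∂F, cdf F x ≠ extendedCdf F s := by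
    refine ae_of_ae_map (f := cdf F) hF.measurable.aemeasurable
      (p := fun u => u ≠ extendedCdf F s) ?_
    rw [map_cdf_eq_restrict_volume F hF]
    exact ae_restrict_of_ae (Measure.ae_ne _ _)
  filter_upwards [h] with x hx hle
  by_contra hs
  refine hx (le_antisymm ?_ hle)
  rw [← extendedCdf_coe]
  exact measureReal_mono fun z hz => hz.trans (not_le.1 hs).le

end Transform

/-! ### The lower bound for the value -/

/-- The expected gain of one step with threshold `r / k`, on the scale of the distribution function:
an observation at `u ≥ c` gains `1` and costs the amount of `lowerValue_sub_ge` with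
`v = k * (u - c)`. -/
theorem integral_step_gain {c r k : ℝ} (hr : 0 < r) (hk : 0 < k) :
    ∫ u in c..(c + r / k), (1 - k * (u - c) / r - 2 * (k * (u - c)) ^ 2 / r ^ 3) =
      (r / 2 - 2 / 3) / k := by
  have h1 := intervalIntegral.integral_comp_sub_right
    (fun u => 1 - k * u / r - 2 * (k * u) ^ 2 / r ^ 3) (a := c) (b := c + r / k) c
  rw [h1, sub_self, add_sub_cancel_left]
  have h2 : (fun u : ℝ => 1 - k * u / r - 2 * (k * u) ^ 2 / r ^ 3) =
      fun u => 1 - k / r * u - 2 * k ^ 2 / r ^ 3 * u ^ 2 := by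
    funext u
    ring
  rw [h2, intervalIntegral.integral_sub (Continuous.intervalIntegrable (by fun_prop) _ _)
    (Continuous.intervalIntegrable (by fun_prop) _ _),
    intervalIntegral.integral_sub (Continuous.intervalIntegrable (by fun_prop) _ _)
    (Continuous.intervalIntegrable (by fun_prop) _ _),
    intervalIntegral.integral_const_mul, intervalIntegral.integral_const_mul, integral_pow,
    integral_id, intervalIntegral.integral_const]
  have hk' : k ≠ 0 := hk.ne'
  have hr' : r ≠ 0 := hr.ne'
  simp only [smul_eq_mul, div_pow]
  norm_num
  field_simp
  ring

section LowerBound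

variable (F : Measure ℝ) [IsProbabilityMeasure F]

/-- The comparison function, at the expected number `k * (1 - extendedCdf F s)` of admissible
observations to come, is a subsolution of the dynamic programming recursion. -/
theorem lowerValue_le_selectionValue (hF : Continuous (cdf F)) (k : ℕ) (s : EReal) :
    lowerValue (k * (1 - extendedCdf F s)) ≤ selectionValue F k s := by
  induction k generalizing s with
  | zero => simp [lowerValue, selectionValue]
  | succ k ih =>
    obtain ⟨hc0, hc1⟩ := extendedCdf_mem_Icc F s
    set c := extendedCdf F s with hc
    have hs := ih s
    rw [← hc] at hs
    push_cast
    rcases lt_or_ge (k * (1 - c)) 2 with hm | hm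
    · refine le_trans (lowerValue_nonpos ?_ ?_) (selectionValue_mem_Icc F (k + 1) s).1
      · exact mul_nonneg (by positivity) (by linarith)
      · linarith
    have hk : (0 : ℝ) < k := by
      by_contra h
      nlinarith
    obtain ⟨r, hr, hrm⟩ : ∃ r : ℝ, 2 ≤ r ∧ k * (1 - c) = r ^ 2 / 2 := by
      refine ⟨√(2 * (k * (1 - c))), Real.le_sqrt_of_sq_le (by linarith), ?_⟩
      rw [Real.sq_sqrt (by linarith), mul_div_cancel_left₀ _ two_ne_zero]
    have hch : c + r / k ≤ 1 := by
      rw [← le_sub_iff_add_le', div_le_iff₀ hk]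
      nlinarith
    let q : ℝ → ℝ := fun u => 1 - k * (u - c) / r - 2 * (k * (u - c)) ^ 2 / r ^ 3
    let I : Set ℝ := Set.Icc c (c + r / k)
    have hqI : IntegrableOn q I := Continuous.integrableOn_Icc (by fun_prop)
    have hsub : I ⊆ Set.Icc 0 1 := Set.Icc_subset_Icc hc0 hch
    have hqI' : Integrable (I.indicator q) (F.map (cdf F)) := by
      rw [map_cdf_eq_restrict_volume F hF]
      exact (hqI.integrable_indicator measurableSet_Icc).restrict
    have hgain : ∫ x, I.indicator q (cdf F x) ∂F = (r / 2 - 2 / 3) / k := by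
      rw [← integral_map hF.measurable.aemeasurable hqI'.aestronglyMeasurable,
        map_cdf_eq_restrict_volume F hF, setIntegral_indicator measurableSet_Icc,
        Set.inter_eq_right.2 hsub, integral_Icc_eq_integral_Ioc,
        ← intervalIntegral.integral_of_le (by simp only [le_add_iff_nonneg_right]; positivity)]
      exact integral_step_gain (by linarith) hk
    have hint : Integrable (fun x => I.indicator q (cdf F x)) F :=
      hqI'.comp_measurable hF.measurable
    -- It is enough to select the observations with `cdf F x ∈ I`.
    have hpt : ∀ᵐ x ∂F, lowerValue (r ^ 2 / 2) + I.indicator q (cdf F x) ≤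
        offerValue (selectionValue F k) s x := by
      filter_upwards [ae_le_of_extendedCdf_le F hF s] with x hx
      by_cases hxI : cdf F x ∈ I
      · have hv := lowerValue_sub_ge hr (v := k * (cdf F x - c))
          (mul_nonneg hk.le (sub_nonneg.2 hxI.1))
          (by rw [mul_comm, ← le_div_iff₀ hk]; linarith [hxI.2])
        have hvx := ih x
        rw [extendedCdf_coe, show k * (1 - cdf F x) = r ^ 2 / 2 - k * (cdf F x - c) by
          rw [← hrm]; ring] at hvx
        rw [Set.indicator_of_mem hxI, offerValue, if_pos (hx hxI.1)]
        refine le_trans ?_ (le_max_right _ _)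
        simp only [q]
        linarith
      · rw [Set.indicator_of_notMem hxI, add_zero, ← hrm]
        exact hs.trans (le_offerValue _ _ _)
    have hmono := integral_mono_ae ((integrable_const _).add hint)
      (integrable_offerValue F k s) hpt
    simp only [Pi.add_apply] at hmono
    rw [integral_add (integrable_const _) hint, hgain, integral_const, probReal_univ,
      one_smul] at hmono
    refine le_trans ?_ hmono
    rw [add_mul, one_mul, hrm]
    exact lowerValue_add_le hr hk (by linarith) hrm

end LowerBound

theorem mainTheorem6 :
    ∃ (C : ℝ) (N : ℕ), ∀ (n : ℕ), N ≤ n →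
      ∀ (Ω : Type*) [MeasurableSpace Ω] (P : Measure Ω) [IsProbabilityMeasure P]
        (F : Measure ℝ) [IsProbabilityMeasure F] (X : Fin n → Ω → ℝ)
        (hX : ∀ i, StronglyMeasurable (X i)),
        Continuous (cdf F) → (∀ i, P.map (X i) = F) → iIndepFun X P →
          (∃ τ, IsOptimalPolicy P X hX τ) ∧
          ∀ τ, IsOptimalPolicy P X hX τ →
            √(2 * (n : ℝ)) - C * Real.log n ≤ expectedSelections P τ := by
  refine ⟨7, 3, fun n hn Ω _ P _ F _ X hX hF hmap hind =>
    ⟨⟨_, isOptimalPolicy_greedy hX hmap hind⟩, fun τ hτ => ?_⟩⟩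
  calc √(2 * (n : ℝ)) - 7 * Real.log n ≤ lowerValue n :=
        le_lowerValue_of_three_le (by exact_mod_cast hn)
    _ ≤ selectionValue F n ⊥ := by
        simpa [extendedCdf_bot] using lowerValue_le_selectionValue F hF n ⊥
    _ = expectedSelections P (policyOfEvents (greedyEvent F X)) :=
        (expectedSelections_greedy hX hmap hind).symm
    _ ≤ expectedSelections P τ := hτ.2 _ isFeasiblePolicy_greedy
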